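/- Let $G$ be a connected complex linear algebraic group, $V$ a finite-dimensional complex vector space and $\rho:G\to\mathrm{GL}(V)$ a rational representation with a (Zariski) open orbit $\Omega\subseteq V$, i.e. $(G,\rho,V)$ is a prehomogeneous vector space. For $v\in V$ let $G_v=\{g\in G:\rho(g)v=v\}$, and for a polynomial $p\in\mathbb{C}[V]$ let $V(p)$ be its zero set. Let $f_1,\dots,f_r\in\mathbb{C}[V]$ be the basic relative invariants, that is, irreducible polynomials such that $V(f_1),\dots,V(f_r)$ are, without repetition, exactly those irreducible components of $V\setminus\Omega$ that are hypersurfaces. An additive function of $G$ is a homomorphism of algebraic groups $\Phi:G\to(\mathbb{C},+)$. A rational function $k$ on $V$ is an additive relative invariant with associated additive function $\Phi$ if $k$ is defined on $\Omega$ and $k(\rho(g)v)-k(v)=\Phi(g)$ for all $v\in\Omega$ and $g\in G$. Let $\mathscr{A}_1(G)$ be the complex vector space of those additive functions $\Phi$ of $G$ that are associated with some additive relative invariant. Let $\Phi_1,\dots,\Phi_s$ be a basis of $\mathscr{A}_1(G)$, and for $1\le i\le s$ let $\frac{h_i}{g_i}$, with $h_i,g_i\in\mathbb{C}[V]$, $g_i\ne0$,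 without common factors, be an additive relative invariant with associated additive function $\Phi_i$. Let $v_0\in\Omega$, and for $1\le j\le r$ let $v_j\in V(f_j)$ with $v_j\notin V(f_k)$ for all $k\neq j$. Then: 1. Each $f_i$ is invariant under the action of $[G,G]\cdot G_{v_0}$, and of $G_{v_j}$ for every $j\in\{1,\dots,r\}$ with $j\ne i$. 2. Each $h_i$ is invariant under the action of $[G,G]\cdot G_{v_0}$, and of $G_{v_j}$ for every $j\in\{1,\dots,r\}$ with $g_i(v_j)\neq0$. 3. The polynomials $f_1,\dots,f_r,h_1,\dots,h_s$ are algebraically independent over $\mathbb{C}$. -/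

import Mathlib

noncomputable section

namespace Prehomogeneous

/-- The Zariski topology on affine space `κ → ℂ`: the topology induced by the map sending a point
to its maximal ideal in the prime spectrum of the polynomial ring. Its closed sets are exactly
the zero loci of ideals of polynomials, see `isClosed_zariski_iff`. -/
@[reducible] def zariski (κ : Type*) : TopologicalSpace (κ → ℂ) :=
  TopologicalSpace.induced (MvPolynomial.pointToPoint (k := ℂ)) inferInstance

theorem isClosed_zariski_iff {κ : Type*} (S : Set (κ → ℂ)) :
    @IsClosed _ (zariski κ) S ↔
      ∃ P : Set (MvPolynomial κ ℂ), S = {x | ∀ p ∈ P, MvPolynomial.eval x p = 0} := by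
  have key : ∀ P : Set (MvPolynomial κ ℂ),
      (MvPolynomial.pointToPoint (k := ℂ)) ⁻¹' (PrimeSpectrum.zeroLocus P) =
        {x : κ → ℂ | ∀ p ∈ P, MvPolynomial.eval x p = 0} := by
    intro P
    ext x
    simp only [Set.mem_preimage, PrimeSpectrum.mem_zeroLocus, Set.mem_ofPred_eq]
    constructor
    · intro h p hp
      have h1 := h hp
      exact (MvPolynomial.mem_vanishingIdeal_singleton_iff x p).1 h1
    · intro h p hp
      exact (MvPolynomial.mem_vanishingIdeal_singleton_iff x p).2 (h p hp)
  rw [isClosed_induced_iff]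
  constructor
  · rintro ⟨t, ht, rfl⟩
    obtain ⟨P, rfl⟩ := (PrimeSpectrum.isClosed_iff_zeroLocus t).1 ht
    exact ⟨P, key P⟩
  · rintro ⟨P, rfl⟩
    exact ⟨_, PrimeSpectrum.isClosed_zeroLocus P, key P⟩

section Group

variable {m : ℕ}

/-- The coordinates of the affine variety `GL_m(ℂ)`: the matrix entries and the inverse of the
determinant. -/
def glCoord (g : GL (Fin m) ℂ) : Option (Fin m × Fin m) → ℂ
  | none => (g : Matrix (Fin m) (Fin m) ℂ).det⁻¹
  | some (i, j) => (g : Matrix (Fin m) (Fin m) ℂ) i j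

/-- The Zariski topology on `GL_m(ℂ)`. -/
@[reducible] def zariskiGL (m : ℕ) : TopologicalSpace (GL (Fin m) ℂ) :=
  TopologicalSpace.induced glCoord (zariski (Option (Fin m × Fin m)))

/-- A connected complex linear algebraic group: a Zariski closed and Zariski connected subgroup
of some `GL_m(ℂ)`. -/
structure IsConnectedAlgebraicGroup (G : Subgroup (GL (Fin m) ℂ)) : Prop where
  isClosed : @IsClosed _ (zariskiGL m) (G : Set (GL (Fin m) ℂ))
  isConnected : @IsConnected _ (zariskiGL m) (G : Set (GL (Fin m) ℂ))

/-- Regular functions on a linear algebraic group `G ≤ GL_m(ℂ)`: restrictions of polynomials in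
the matrix entries and the inverse of the determinant. -/
def IsRegular (G : Subgroup (GL (Fin m) ℂ)) (F : G → ℂ) : Prop :=
  ∃ p : MvPolynomial (Option (Fin m × Fin m)) ℂ,
    ∀ g : G, F g = MvPolynomial.eval (glCoord (g : GL (Fin m) ℂ)) p

/-- The complex vector space of additive functions of `G`, that is, of homomorphisms of algebraic
groups from `G` to `(ℂ, +)`. -/
def additiveFunctions (G : Subgroup (GL (Fin m) ℂ)) : Submodule ℂ (G → ℂ) where
  carrier := {Φ | IsRegular G Φ ∧ ∀ g h : G, Φ (g * h) = Φ g + Φ h}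
  zero_mem' := ⟨⟨0, fun g => by simp⟩, fun g h => by simp⟩
  add_mem' := by
    rintro Φ Ψ ⟨⟨p, hp⟩, hΦ⟩ ⟨⟨q, hq⟩, hΨ⟩
    refine ⟨⟨p + q, fun g => by simp [hp, hq]⟩, fun g h => ?_⟩
    simp only [Pi.add_apply, hΦ, hΨ]
    ring
  smul_mem' := by
    rintro c Φ ⟨⟨p, hp⟩, hΦ⟩
    refine ⟨⟨MvPolynomial.C c * p, fun g => by simp [hp]⟩, fun g h => ?_⟩
    simp only [Pi.smul_apply, hΦ, smul_add]

end Group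

section Space

variable {m n : ℕ} {V : Type*} [AddCommGroup V] [Module ℂ V]

/-- The value at `v` of a polynomial in the coordinates of `V` given by the basis `b`. -/
def value (b : Module.Basis (Fin n) ℂ V) (p : MvPolynomial (Fin n) ℂ) (v : V) : ℂ :=
  MvPolynomial.eval (b.equivFun v) p

/-- The Zariski topology on `V`. -/
@[reducible] def zariskiV (b : Module.Basis (Fin n) ℂ V) : TopologicalSpace V :=
  TopologicalSpace.induced b.equivFun (zariski (Fin n))

/-- The zero set `V(p)` of a polynomial `p`. -/
def zeroSet (b : Module.Basis (Fin n) ℂ V) (p : MvPolynomial (Fin n) ℂ) : Set V :=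
  {v | value b p v = 0}

/-- The quotient `p / q` in the field of rational functions on `V`. -/
def frac (p q : MvPolynomial (Fin n) ℂ) : FractionRing (MvPolynomial (Fin n) ℂ) :=
  algebraMap _ _ p / algebraMap _ _ q

/-- The rational function `φ` on `V` is defined at `v`, with value `c`. -/
def HasValue (b : Module.Basis (Fin n) ℂ V) (φ : FractionRing (MvPolynomial (Fin n) ℂ))
    (v : V) (c : ℂ) : Prop :=
  ∃ p q : MvPolynomial (Fin n) ℂ,
    value b q v ≠ 0 ∧ φ = frac p q ∧ c = value b p v / value b q v

/-- A representation of `G` on `V` is rational if its matrix coefficients are regular. -/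
def IsRational {G : Subgroup (GL (Fin m) ℂ)} (ρ : Representation ℂ G V) : Prop :=
  ∀ (v : V) (l : Module.Dual ℂ V), IsRegular G (fun g => l (ρ g v))

/-- The isotropy subgroup `G_v`. -/
def isotropy {G : Subgroup (GL (Fin m) ℂ)} (ρ : Representation ℂ G V) (v : V) : Subgroup G where
  carrier := {g | ρ g v = v}
  one_mem' := by simp
  mul_mem' := by
    intro g h hg hh
    simp only [Set.mem_ofPred_eq] at hg hh ⊢
    rw [map_mul, Module.End.mul_apply, hh, hg]
  inv_mem' := by
    intro g hg
    simp only [Set.mem_ofPred_eq] at hg ⊢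
    conv_lhs => rw [← hg]
    rw [← Module.End.mul_apply, ← map_mul, inv_mul_cancel, map_one, Module.End.one_apply]

/-- `(G, ρ, V)` is a prehomogeneous vector space with open orbit `Ω`. -/
structure IsPrehomogeneous (b : Module.Basis (Fin n) ℂ V) (G : Subgroup (GL (Fin m) ℂ))
    (ρ : Representation ℂ G V) (Ω : Set V) : Prop where
  group : IsConnectedAlgebraicGroup G
  rational : IsRational ρ
  isOrbit : ∃ v : V, Ω = Set.range (fun g : G => ρ g v)
  isOpen : @IsOpen _ (zariskiV b) Ω

/-- `Z` is an irreducible component of the subset `S` of `V`. -/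
def IsIrreducibleComponent (b : Module.Basis (Fin n) ℂ V) (S Z : Set V) : Prop :=
  Maximal (fun T : Set V => @IsIrreducible V (zariskiV b) T ∧ T ⊆ S) Z

/-- A hypersurface is the zero set of a nonconstant polynomial. -/
def IsHypersurface (b : Module.Basis (Fin n) ℂ V) (Z : Set V) : Prop :=
  ∃ p : MvPolynomial (Fin n) ℂ, 0 < p.totalDegree ∧ Z = zeroSet b p

/-- `f 1, …, f r` are the basic relative invariants: irreducible polynomials whose zero sets are,
without repetition, the irreducible components of `V \ Ω` that are hypersurfaces. -/
structure IsBasicRelativeInvariants (b : Module.Basis (Fin n) ℂ V) (Ω : Set V) {r : ℕ}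
    (f : Fin r → MvPolynomial (Fin n) ℂ) : Prop where
  irreducible : ∀ i, Irreducible (f i)
  distinct : Function.Injective (fun i => zeroSet b (f i))
  components : ∀ Z : Set V,
    (IsIrreducibleComponent b Ωᶜ Z ∧ IsHypersurface b Z) ↔ ∃ i, zeroSet b (f i) = Z

/-- The rational function `φ` on `V` is an additive relative invariant with associated additive
function `Φ`: it is defined on `Ω`, and `φ (ρ g v) - φ v = Φ g` for all `v ∈ Ω`, `g ∈ G`. -/
def IsAdditiveRelativeInvariant (b : Module.Basis (Fin n) ℂ V) {G : Subgroup (GL (Fin m) ℂ)}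
    (ρ : Representation ℂ G V) (Ω : Set V) (φ : FractionRing (MvPolynomial (Fin n) ℂ))
    (Φ : G → ℂ) : Prop :=
  Φ ∈ additiveFunctions G ∧
    ∀ v ∈ Ω, ∀ g : G, ∃ c d : ℂ, HasValue b φ (ρ g v) c ∧ HasValue b φ v d ∧ c - d = Φ g

theorem HasValue.add {b : Module.Basis (Fin n) ℂ V} {φ ψ : FractionRing (MvPolynomial (Fin n) ℂ)}
    {v : V} {c d : ℂ} (hφ : HasValue b φ v c) (hψ : HasValue b ψ v d) :
    HasValue b (φ + ψ) v (c + d) := by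
  obtain ⟨p, q, hq, rfl, rfl⟩ := hφ
  obtain ⟨p', q', hq', rfl, rfl⟩ := hψ
  have h0 : ∀ q : MvPolynomial (Fin n) ℂ, value b q v ≠ 0 →
      algebraMap _ (FractionRing (MvPolynomial (Fin n) ℂ)) q ≠ 0 := by
    intro q hq h
    apply hq
    rw [(IsFractionRing.to_map_eq_zero_iff).1 h]
    simp [value]
  refine ⟨p * q' + q * p', q * q', ?_, ?_, ?_⟩
  · simpa [value] using ⟨hq, hq'⟩
  · simp only [frac, map_add, map_mul]
    rw [div_add_div _ _ (h0 q hq) (h0 q' hq')]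
  · rw [div_add_div _ _ hq hq']
    simp [value]

theorem HasValue.smul {b : Module.Basis (Fin n) ℂ V} {φ : FractionRing (MvPolynomial (Fin n) ℂ)}
    {v : V} {c : ℂ} (a : ℂ) (hφ : HasValue b φ v c) :
    HasValue b (algebraMap (MvPolynomial (Fin n) ℂ) _ (MvPolynomial.C a) * φ) v (a * c) := by
  obtain ⟨p, q, hq, rfl, rfl⟩ := hφ
  refine ⟨MvPolynomial.C a * p, q, hq, ?_, ?_⟩
  · simp only [frac, map_mul]
    rw [mul_div_assoc]
  · simp [value, mul_div_assoc]

/-- The space `𝒜₁(G)` of the additive functions of `G` that are associated with some additive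
relative invariant. -/
def additiveFunctionsOne (b : Module.Basis (Fin n) ℂ V) {G : Subgroup (GL (Fin m) ℂ)}
    (ρ : Representation ℂ G V) (Ω : Set V) : Submodule ℂ (G → ℂ) where
  carrier := {Φ | ∃ φ, IsAdditiveRelativeInvariant b ρ Ω φ Φ}
  zero_mem' := by
    refine ⟨0, Submodule.zero_mem _, fun v _ g => ?_⟩
    have h : ∀ w : V, HasValue b 0 w 0 := fun w => ⟨0, 1, by simp [value, frac]⟩
    exact ⟨0, 0, h _, h _, by simp⟩
  add_mem' := by
    rintro Φ Ψ ⟨φ, hΦ, hφ⟩ ⟨ψ, hΨ, hψ⟩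
    refine ⟨φ + ψ, Submodule.add_mem _ hΦ hΨ, fun v hv g => ?_⟩
    obtain ⟨c, d, hc, hd, h⟩ := hφ v hv g
    obtain ⟨c', d', hc', hd', h'⟩ := hψ v hv g
    refine ⟨c + c', d + d', hc.add hc', hd.add hd', ?_⟩
    rw [Pi.add_apply, ← h, ← h']
    ring
  smul_mem' := by
    rintro a Φ ⟨φ, hΦ, hφ⟩
    refine ⟨algebraMap (MvPolynomial (Fin n) ℂ) _ (MvPolynomial.C a) * φ,
      Submodule.smul_mem _ a hΦ, fun v hv g => ?_⟩
    obtain ⟨c, d, hc, hd, h⟩ := hφ v hv g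
    refine ⟨a * c, a * d, hc.smul a, hd.smul a, ?_⟩
    rw [Pi.smul_apply, ← h, smul_eq_mul]
    ring

/-- The polynomial `p` is invariant under the action of the subgroup `K` of `G` on `V`. -/
def IsInvariantUnder (b : Module.Basis (Fin n) ℂ V) {G : Subgroup (GL (Fin m) ℂ)}
    (ρ : Representation ℂ G V) (K : Subgroup G) (p : MvPolynomial (Fin n) ℂ) : Prop :=
  ∀ g ∈ K, ∀ v : V, value b p (ρ g v) = value b p v

end Space

end Prehomogeneous

end

/-!
Over the connected group `G` the finitely many hypersurface components of `Ωᶜ` cannot be permuted,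
so each `f i` is a relative invariant, with some character `χ i`. A lowest-terms denominator `g i`
has no zero on `Ω`, hence is a constant times a product of the `f j`, and is again a relative
invariant; comparing `h i / g i` at `ρ a v` and at `v` gives
`h i (ρ a v) = χ a * (h i v + Φ i a * g i v)`, with `χ` the character of `g i`. Characters and
additive functions vanish on the commutator subgroup, and also on the isotropy group of any point
at which `f i`, respectively `g i`, does not vanish: this gives the invariance.

For the algebraic independence, pull everything back to the group along an orbit map
`a ↦ ρ a v₀`, which turns `f i` into a multiple of `χ i` and `h i / g i` into `Φ i` plus a constant.
Distinct characters are linearly independent not only over the constants (Dedekind) but over the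
functions on the group annihilated by iterated differences, a ring which contains the `Φ i`. As the
monomials in the `χ i` are pairwise distinct, the `χ i` are algebraically independent over that
ring. The `Φ i` are algebraically independent because a polynomial relation between them vanishes
on the additive monoid of their values, whose span is everything.
-/

noncomputable section

namespace Prehomogeneous

section PolynomialFunctions

variable {A K : Type*} [Group A] [Field K]

/-- The difference operator `F ↦ (x ↦ F (x * a) - F x)` on functions on a group, which lowers the
degree of polynomial functions. -/
def difference (a : A) : (A → K) →ₗ[K] A → K :=
  LinearMap.funLeft K K (· * a) - LinearMap.id

theorem difference_apply (a : A) (F : A → K) (x : A) : difference a F x = F (x * a) - F x :=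
  rfl

theorem difference_mul (a : A) (F H : A → K) :
    difference a (F * H) =
      difference a F * H + F * difference a H + difference a F * difference a H := by
  ext x
  simp only [difference_apply, Pi.mul_apply, Pi.add_apply]
  ring

variable (A K) in
/-- The functions on a group that are polynomial of degree less than `n` in the sense of Fréchet:
every `n`-fold iterated difference vanishes. -/
def polynomialOfDegreeLT : ℕ → Submodule K (A → K)
  | 0 => ⊥
  | n + 1 => ⨅ a : A, (polynomialOfDegreeLT n).comap (difference a)

theorem mem_polynomialOfDegreeLT_succ {n : ℕ} {F : A → K} :
    F ∈ polynomialOfDegreeLT A K (n + 1) ↔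
      ∀ a, difference a F ∈ polynomialOfDegreeLT A K n := by
  simp only [polynomialOfDegreeLT, Submodule.mem_iInf, Submodule.mem_comap]

theorem polynomialOfDegreeLT_mono : Monotone (polynomialOfDegreeLT A K) := by
  refine monotone_nat_of_le_succ fun n => ?_
  induction n with
  | zero => exact bot_le
  | succ n ih => exact iInf_mono fun a => Submodule.comap_mono ih

theorem difference_mem_polynomialOfDegreeLT {n : ℕ} {F : A → K}
    (hF : F ∈ polynomialOfDegreeLT A K n) (a : A) :
    difference a F ∈ polynomialOfDegreeLT A K n :=
  mem_polynomialOfDegreeLT_succ.1 (polynomialOfDegreeLT_mono n.le_succ hF) a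

theorem mul_mem_polynomialOfDegreeLT {k l : ℕ} {F H : A → K}
    (hF : F ∈ polynomialOfDegreeLT A K k) (hH : H ∈ polynomialOfDegreeLT A K l) :
    F * H ∈ polynomialOfDegreeLT A K (k + l) := by
  induction k generalizing l F H with
  | zero => rw [(Submodule.mem_bot K).1 hF, zero_mul]; exact zero_mem _
  | succ k ihk =>
    induction l generalizing H with
    | zero => rw [(Submodule.mem_bot K).1 hH, mul_zero]; exact zero_mem _
    | succ l ihl =>
      refine mem_polynomialOfDegreeLT_succ (n := k + 1 + l).2 fun a => ?_
      have hFa := mem_polynomialOfDegreeLT_succ.1 hF a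
      have hHa := mem_polynomialOfDegreeLT_succ.1 hH a
      rw [difference_mul]
      exact add_mem
        (add_mem (polynomialOfDegreeLT_mono (by lia : k + (l + 1) ≤ _) (ihk hFa hH)) (ihl hHa))
        (polynomialOfDegreeLT_mono (by lia : k + l ≤ _) (ihk hFa hHa))

theorem const_mem_polynomialOfDegreeLT (c : K) :
    (fun _ => c) ∈ polynomialOfDegreeLT A K 1 :=
  mem_polynomialOfDegreeLT_succ.2 fun a => (Submodule.mem_bot K).2 <| by
    ext x
    simp only [difference_apply, sub_self, Pi.zero_apply]

theorem additive_mem_polynomialOfDegreeLT {φ : A → K} (hφ : ∀ x y, φ (x * y) = φ x + φ y) :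
    φ ∈ polynomialOfDegreeLT A K 2 := by
  refine mem_polynomialOfDegreeLT_succ.2 fun a => ?_
  have hconst : difference a φ = fun _ => φ a := by
    ext x
    rw [difference_apply, hφ, add_sub_cancel_left]
  rw [hconst]
  exact const_mem_polynomialOfDegreeLT _

theorem eq_zero_of_smul_eq_smul_difference {n : ℕ} {F : A → K}
    (hF : F ∈ polynomialOfDegreeLT A K n) {c d : K} (hc : c ≠ 0) {a : A}
    (h : c • F = d • difference a F) : F = 0 := by
  induction n with
  | zero => exact (Submodule.mem_bot K).1 hF
  | succ n ih =>
    refine ih (((polynomialOfDegreeLT A K n).smul_mem_iff hc).1 ?_)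
    rw [h]
    exact Submodule.smul_mem _ _ (mem_polynomialOfDegreeLT_succ.1 hF a)

variable (A K) in
/-- The algebra of polynomial functions on a group, in the sense of Fréchet. It contains the
additive functions, and is the ring over which the characters are shown to be independent. -/
def polynomialFunctions : Subalgebra K (A → K) where
  carrier := {F | ∃ n, F ∈ polynomialOfDegreeLT A K n}
  mul_mem' := fun ⟨k, hF⟩ ⟨l, hH⟩ => ⟨k + l, mul_mem_polynomialOfDegreeLT hF hH⟩
  add_mem' := fun ⟨k, hF⟩ ⟨l, hH⟩ => ⟨max k l, add_mem
    (polynomialOfDegreeLT_mono (le_max_left k l) hF)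
    (polynomialOfDegreeLT_mono (le_max_right k l) hH)⟩
  algebraMap_mem' c := ⟨1, const_mem_polynomialOfDegreeLT c⟩

theorem sum_character_mul_translate_eq_zero {s : Finset (A →* K)} {F : (A →* K) → A → K}
    (h : ∀ x, ∑ χ ∈ s, χ x * F χ x = 0) (b : A) (c : K) (x : A) :
    ∑ χ ∈ s, χ x * (χ b • difference b (F χ) + (χ b - c) • F χ) x = 0 :=
  calc
    _ = ∑ χ ∈ s, χ (x * b) * F χ (x * b) - c * ∑ χ ∈ s, χ x * F χ x := by
      rw [Finset.mul_sum, ← Finset.sum_sub_distrib]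
      refine Finset.sum_congr rfl fun χ _ => ?_
      simp only [Pi.add_apply, Pi.smul_apply, smul_eq_mul, difference_apply, map_mul]
      ring
    _ = 0 := by rw [h, h, mul_zero, sub_zero]

theorem translate_mem_polynomialFunctions {F : A → K} (hF : F ∈ polynomialFunctions A K) (b : A)
    (c d : K) : c • difference b F + d • F ∈ polynomialFunctions A K :=
  have ⟨n, hn⟩ := hF
  ⟨n, add_mem (Submodule.smul_mem _ c (difference_mem_polynomialOfDegreeLT hn b))
    (Submodule.smul_mem _ d hn)⟩

theorem eq_zero_of_sum_character_mul_eq_zero {s : Finset (A →* K)} {F : (A →* K) → A → K}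
    (hF : ∀ χ, F χ ∈ polynomialFunctions A K) (h : ∀ x, ∑ χ ∈ s, χ x * F χ x = 0) :
    ∀ χ ∈ s, F χ = 0 := by
  classical
  induction s using Finset.induction_on generalizing F with
  | empty => exact fun χ hχ => absurd hχ (Finset.notMem_empty χ)
  | insert ψ s hψ ih =>
    obtain ⟨n, hn⟩ := hF ψ
    rw [Finset.forall_mem_insert]
    induction n generalizing F with
    | zero =>
      have hFψ : F ψ = 0 := (Submodule.mem_bot K).1 hn
      refine ⟨hFψ, ih hF fun x => ?_⟩
      simpa only [Finset.sum_insert hψ, hFψ, Pi.zero_apply, mul_zero, zero_add] using h x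
    | succ n ihn =>
      have hs : ∀ χ ∈ s, F χ = 0 := by
        intro χ hχ
        obtain ⟨b, hb⟩ := DFunLike.ne_iff.1 (ne_of_mem_of_not_mem hχ hψ)
        -- Translating the relation by `b` and subtracting `ψ b` times it lowers the degree at `ψ`.
        have hψ_degree : ψ b • difference b (F ψ) + (ψ b - ψ b) • F ψ ∈
            polynomialOfDegreeLT A K n := by
          rw [sub_self, zero_smul, add_zero]
          exact Submodule.smul_mem _ _ (mem_polynomialOfDegreeLT_succ.1 hn b)
        have hχ_zero : χ b • difference b (F χ) + (χ b - ψ b) • F χ = 0 :=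
          (ihn (fun χ => translate_mem_polynomialFunctions (hF χ) b _ _)
            (sum_character_mul_translate_eq_zero h b (ψ b)) hψ_degree).2 χ hχ
        obtain ⟨k, hk⟩ := hF χ
        refine eq_zero_of_smul_eq_smul_difference hk (sub_ne_zero.2 hb.symm) (d := χ b) (a := b) ?_
        rw [← neg_sub, neg_smul]
        exact (eq_neg_of_add_eq_zero_left hχ_zero).symm
      have hψ_zero (x : A) : ψ x * F ψ x = 0 := by
        rw [← h x, Finset.sum_insert hψ, Finset.sum_eq_zero fun χ hχ => by
          rw [hs χ hχ, Pi.zero_apply, mul_zero], add_zero]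
      exact ⟨funext fun x => (mul_eq_zero.1 (hψ_zero x)).resolve_left
        ((Group.isUnit x).map ψ).ne_zero, hs⟩

theorem linearIndependent_character_polynomialFunctions :
    LinearIndependent (polynomialFunctions A K) fun χ : A →* K => (χ : A → K) := by
  classical
  refine linearIndependent_iff'.2 fun s c h χ hχ => Subtype.ext ?_
  refine eq_zero_of_sum_character_mul_eq_zero (F := fun χ => c χ) (fun χ => (c χ).2)
    (fun x => ?_) χ hχ
  refine Eq.trans ?_ (congrFun h x)
  rw [Finset.sum_apply]
  exact Finset.sum_congr rfl fun χ _ => mul_comm _ _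

theorem algebraicIndependent_of_linearIndependent_monomials {σ R B : Type*} [CommRing R]
    [CommRing B] [Algebra R B] {x : σ → B}
    (h : LinearIndependent R fun γ : σ →₀ ℕ => γ.prod fun i k => x i ^ k) :
    AlgebraicIndependent R x := by
  refine algebraicIndependent_iff.2 fun p hp => MvPolynomial.ext _ _ fun γ => ?_
  by_cases hγ : γ ∈ p.support
  · refine linearIndependent_iff'.1 h p.support p.coeff ?_ γ hγ
    simpa only [MvPolynomial.aeval_def, MvPolynomial.eval₂_eq, Algebra.smul_def,
      Finsupp.prod] using hp
  · exact MvPolynomial.notMem_support_iff.1 hγ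

theorem algebraicIndependent_character {σ : Type*} {χ : σ → A →* K}
    (hχ : Function.Injective fun γ : σ →₀ ℕ => γ.prod fun i k => χ i ^ k) :
    AlgebraicIndependent (polynomialFunctions A K) fun i => (χ i : A → K) := by
  refine algebraicIndependent_of_linearIndependent_monomials ?_
  have hmonomial (γ : σ →₀ ℕ) : (γ.prod fun i k => (χ i : A → K) ^ k) =
      (γ.prod fun i k => χ i ^ k : A →* K) := by
    ext x
    simp only [Finsupp.prod, Finset.prod_apply, Pi.pow_apply, MonoidHom.finsetProd_apply,
      MonoidHom.pow_apply]
  simp only [hmonomial]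
  exact linearIndependent_character_polynomialFunctions.comp _ hχ

end PolynomialFunctions

section AdditiveFunctions

theorem eval_eq_zero_of_mem_span {σ K : Type*} [Field K] [CharZero K] {S : AddSubmonoid (σ → K)}
    {P : MvPolynomial σ K} (hP : ∀ x ∈ S, MvPolynomial.eval x P = 0) {x : σ → K}
    (hx : x ∈ Submodule.span K (S : Set (σ → K))) :
    MvPolynomial.eval x P = 0 := by
  obtain ⟨n, c, s, rfl⟩ := Submodule.mem_span_set'.1 hx
  -- `t ↦ P (∑ j, t j • s j)` vanishes at the points with natural coordinates, hence everywhere.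
  let Q : MvPolynomial (Fin n) K :=
    MvPolynomial.bind₁ (fun i => ∑ j, MvPolynomial.C ((s j : σ → K) i) * MvPolynomial.X j) P
  have hQ (t : Fin n → K) :
      MvPolynomial.eval t Q = MvPolynomial.eval (∑ j, t j • (s j : σ → K)) P := by
    refine (MvPolynomial.eval₂Hom_bind₁ (RingHom.id K) t _ P).trans ?_
    congr 2
    ext i
    simp [mul_comm]
  have hQ0 : Q = 0 := by
    refine MvPolynomial.funext_set (fun _ => Set.range (Nat.cast : ℕ → K))
      (fun _ => Set.infinite_range_of_injective Nat.cast_injective) fun t ht => ?_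
    choose k hk using fun j => ht j trivial
    rw [hQ, map_zero]
    refine hP _ (sum_mem fun j _ => ?_)
    rw [← hk j, Nat.cast_smul_eq_nsmul]
    exact nsmul_mem (s j).2 _
  rw [← hQ, hQ0, map_zero]

variable {A K ι : Type*} [Group A] [Field K] [CharZero K]

theorem algebraicIndependent_of_additive {φ : ι → A → K}
    (hadd : ∀ i x y, φ i (x * y) = φ i x + φ i y) (hφ : LinearIndependent K φ) :
    AlgebraicIndependent K φ := by
  refine algebraicIndependent_of_finite_type fun t ht => ?_
  have := ht.to_subtype
  let evalHom : Additive A →+ (t → K) :=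
    AddMonoidHom.mk' (fun x i => φ i x.toMul) fun x y => funext fun i => hadd i x.toMul y.toMul
  have hspan : Submodule.span K (AddMonoidHom.mrange evalHom : Set (t → K)) = ⊤ :=
    span_flip_eq_top_iff_linearIndependent.2 (hφ.comp _ Subtype.val_injective)
  refine algebraicIndependent_iff.2 fun P hP => MvPolynomial.funext fun x => ?_
  rw [map_zero]
  refine eval_eq_zero_of_mem_span ?_ (hspan ▸ Submodule.mem_top : x ∈ Submodule.span K _)
  rintro _ ⟨a, rfl⟩
  have ha := congrArg (Pi.evalAlgHom K (fun _ : A => K) a.toMul) hP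
  rwa [MvPolynomial.comp_aeval_apply, MvPolynomial.aeval_eq_eval] at ha

theorem algebraicIndependent_sumElim_character_additive {σ : Type*} {χ : σ → A →* K}
    (hχ : Function.Injective fun γ : σ →₀ ℕ => γ.prod fun i k => χ i ^ k) {φ : ι → A → K}
    (hadd : ∀ i x y, φ i (x * y) = φ i x + φ i y) (hφ : LinearIndependent K φ) :
    AlgebraicIndependent K (Sum.elim (fun i => (χ i : A → K)) φ) := by
  refine (algebraicIndependent_of_additive hadd hφ).sumElim_of_tower (S := polynomialFunctions A K)
    ?_ (algebraicIndependent_character hχ)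
  rintro _ ⟨i, rfl⟩
  exact ⟨⟨φ i, 2, additive_mem_polynomialOfDegreeLT (hadd i)⟩, rfl⟩

end AdditiveFunctions

section Affine

variable {ι κ R B : Type*} [CommRing R] [CommRing B] [Algebra R B]

theorem algebraicIndependent_affine [Nontrivial R] {x : ι → B} (hx : AlgebraicIndependent R x)
    {u w : ι → R} (hu : ∀ i, u i ∈ nonZeroDivisors R) :
    AlgebraicIndependent R fun i => algebraMap R B (u i) * x i + algebraMap R B (w i) := by
  have htrans (i : ι) :
      Transcendental R (Polynomial.C (u i) * Polynomial.X + Polynomial.C (w i)) := by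
    have hui : u i ≠ 0 := nonZeroDivisors.ne_zero (hu i)
    refine Polynomial.transcendental _ ?_ ?_
    · rw [Polynomial.natDegree_linear hui]
      exact one_ne_zero
    · rw [Polynomial.leadingCoeff_linear hui]
      exact hu i
  simpa only [map_add, map_mul, Polynomial.aeval_C, Polynomial.aeval_X] using
    hx.polynomial_aeval_of_transcendental htrans

theorem algebraicIndependent_sumElim_mul_character_add {A K σ : Type*} [Group A] [Field K]
    [CharZero K] {χ : σ → A →* K}
    (hχ : Function.Injective fun γ : σ →₀ ℕ => γ.prod fun i k => χ i ^ k) {φ : ι → A → K}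
    (hadd : ∀ i x y, φ i (x * y) = φ i x + φ i y) (hφ : LinearIndependent K φ) {c : σ → K}
    (hc : ∀ i, c i ≠ 0) (d : ι → K) :
    AlgebraicIndependent K (Sum.elim (fun i x => c i * χ i x) fun i x => φ i x + d i) := by
  let u : σ ⊕ ι → K := Sum.elim c 1
  let w : σ ⊕ ι → K := Sum.elim 0 d
  have hu : ∀ i, u i ∈ nonZeroDivisors K := by
    rintro (i | _)
    · exact mem_nonZeroDivisors_of_ne_zero (hc i)
    · exact one_mem _
  have haffine : (Sum.elim (fun i x => c i * χ i x) fun i x => φ i x + d i) = fun i =>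
      algebraMap K (A → K) (u i) * Sum.elim (fun i => (χ i : A → K)) φ i +
        algebraMap K (A → K) (w i) := by
    ext (i | i) x <;> simp [u, w]
  rw [haffine]
  exact algebraicIndependent_affine (algebraicIndependent_sumElim_character_additive hχ hadd hφ) hu

theorem algebraicIndependent_sumElim_swap {x : ι → B} {y : κ → B} :
    AlgebraicIndependent R (Sum.elim x y) ↔ AlgebraicIndependent R (Sum.elim y x) := by
  rw [← algebraicIndependent_equiv (Equiv.sumComm ι κ), Equiv.sumComm_apply, Sum.elim_swap]

theorem algebraicIndependent_sumElim_mul_right [Nontrivial R] {x : ι → B} {y : κ → B}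
    (hxy : AlgebraicIndependent R (Sum.elim x y)) {u : κ → B}
    (hu : ∀ k, u k ∈ Algebra.adjoin R (Set.range x)) (hu0 : ∀ k, u k ∈ nonZeroDivisors B) :
    AlgebraicIndependent R (Sum.elim x (u * y)) := by
  have hyx := algebraicIndependent_sumElim_swap.1 hxy
  have : Nontrivial B := hyx.algebraMap_injective.nontrivial
  obtain ⟨hx, hy⟩ := AlgebraicIndependent.sumElim_iff.1 hyx
  refine algebraicIndependent_sumElim_swap.1 (hx.sumElim ?_)
  have huy := algebraicIndependent_affine hy (u := fun k => ⟨u k, hu k⟩) (w := 0) fun k =>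
    mem_nonZeroDivisors_of_injective (f := (Algebra.adjoin R (Set.range x)).val)
      Subtype.val_injective (hu0 k)
  simp only [Pi.zero_apply, map_zero, add_zero] at huy
  exact huy

end Affine

section ZariskiTopology

variable {n : ℕ} {V : Type*} [AddCommGroup V] [Module ℂ V] {b : Module.Basis (Fin n) ℂ V}

theorem value_mul (p q : MvPolynomial (Fin n) ℂ) (v : V) :
    value b (p * q) v = value b p v * value b q v :=
  map_mul _ p q

theorem value_add (p q : MvPolynomial (Fin n) ℂ) (v : V) :
    value b (p + q) v = value b p v + value b q v :=
  map_add _ p q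

theorem value_C (c : ℂ) (v : V) : value b (MvPolynomial.C c) v = c :=
  MvPolynomial.eval_C c

theorem ne_zero_of_value_ne_zero {p : MvPolynomial (Fin n) ℂ} {v : V} (h : value b p v ≠ 0) :
    p ≠ 0 := by
  rintro rfl
  exact h (map_zero _)

theorem value_equivFun_symm (p : MvPolynomial (Fin n) ℂ) (x : Fin n → ℂ) :
    value b p (b.equivFun.symm x) = MvPolynomial.eval x p := by
  rw [value, LinearEquiv.apply_symm_apply]

theorem eq_of_value_eq {p q : MvPolynomial (Fin n) ℂ} (h : ∀ v, value b p v = value b q v) :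
    p = q :=
  MvPolynomial.funext fun x => by
    simpa only [value_equivFun_symm] using h (b.equivFun.symm x)

theorem mem_zeroSet_mul {p q : MvPolynomial (Fin n) ℂ} {v : V} :
    v ∈ zeroSet b (p * q) ↔ v ∈ zeroSet b p ∨ v ∈ zeroSet b q := by
  simp only [zeroSet, Set.mem_ofPred_eq, value_mul, mul_eq_zero]

theorem zeroSet_subset_of_dvd {p q : MvPolynomial (Fin n) ℂ} (h : p ∣ q) :
    zeroSet b p ⊆ zeroSet b q := by
  obtain ⟨e, rfl⟩ := h
  exact fun v hv => mem_zeroSet_mul.2 (Or.inl hv)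

theorem dvd_of_zeroSet_subset {p q : MvPolynomial (Fin n) ℂ} (hp : Irreducible p)
    (h : zeroSet b p ⊆ zeroSet b q) : p ∣ q := by
  have : (Ideal.span {p}).IsPrime := (Ideal.span_singleton_prime hp.ne_zero).2 hp.prime
  rw [← Ideal.mem_span_singleton,
    ← MvPolynomial.IsPrime.vanishingIdeal_zeroLocus (K := ℂ) (Ideal.span {p}),
    MvPolynomial.mem_vanishingIdeal_iff]
  intro x hx
  have hpx := hx p (Ideal.mem_span_singleton_self p)
  rw [MvPolynomial.aeval_eq_eval, ← value_equivFun_symm (b := b)] at hpx ⊢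
  exact h hpx

theorem isClosed_zariskiV_iff {S : Set V} :
    @IsClosed _ (zariskiV b) S ↔
      ∃ P : Set (MvPolynomial (Fin n) ℂ), S = ⋂ p ∈ P, zeroSet b p := by
  have hpreimage (P : Set (MvPolynomial (Fin n) ℂ)) :
      b.equivFun ⁻¹' {x | ∀ p ∈ P, MvPolynomial.eval x p = 0} = ⋂ p ∈ P, zeroSet b p := by
    ext v
    rw [Set.mem_iInter₂]
    rfl
  rw [@isClosed_induced_iff V _ (zariski (Fin n))]
  constructor
  · rintro ⟨t, ht, rfl⟩
    obtain ⟨P, rfl⟩ := (isClosed_zariski_iff t).1 ht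
    exact ⟨P, hpreimage P⟩
  · rintro ⟨P, rfl⟩
    exact ⟨_, (isClosed_zariski_iff _).2 ⟨P, rfl⟩, hpreimage P⟩

theorem isClosed_zeroSet (p : MvPolynomial (Fin n) ℂ) : @IsClosed _ (zariskiV b) (zeroSet b p) :=
  isClosed_zariskiV_iff.2 ⟨{p}, Set.biInter_singleton p _ |>.symm⟩

theorem isIrreducible_zariskiV_iff {T : Set V} :
    @IsIrreducible _ (zariskiV b) T ↔ T.Nonempty ∧
      ∀ p q, T ⊆ zeroSet b (p * q) → T ⊆ zeroSet b p ∨ T ⊆ zeroSet b q := by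
  let _ := zariskiV b
  refine and_congr_right fun _ => isPreirreducible_iff_isClosed_union_isClosed.trans
    ⟨fun h p q hpq => ?_, fun h Z₁ Z₂ h₁ h₂ hZ => ?_⟩
  · exact h _ _ (isClosed_zeroSet p) (isClosed_zeroSet q) fun v hv => mem_zeroSet_mul.1 (hpq hv)
  · obtain ⟨P₁, rfl⟩ := isClosed_zariskiV_iff.1 h₁
    obtain ⟨P₂, rfl⟩ := isClosed_zariskiV_iff.1 h₂
    by_contra! hcon
    simp only [Set.subset_iInter₂_iff, not_forall] at hcon
    obtain ⟨⟨p, hp, hTp⟩, q, hq, hTq⟩ := hcon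
    refine (h p q fun v hv => mem_zeroSet_mul.2 ?_).elim hTp hTq
    exact (hZ hv).imp (fun h => Set.mem_iInter₂.1 h p hp) fun h => Set.mem_iInter₂.1 h q hq

theorem isIrreducible_zeroSet {p : MvPolynomial (Fin n) ℂ} (hp : Irreducible p) :
    @IsIrreducible _ (zariskiV b) (zeroSet b p) := by
  refine isIrreducible_zariskiV_iff.2 ⟨Set.nonempty_iff_ne_empty.2 fun hempty => ?_,
    fun q₁ q₂ h => ?_⟩
  · exact hp.not_isUnit (isUnit_of_dvd_one
      (dvd_of_zeroSet_subset (b := b) hp (hempty ▸ Set.empty_subset _)))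
  · exact (hp.prime.dvd_or_dvd (dvd_of_zeroSet_subset hp h)).imp zeroSet_subset_of_dvd
      zeroSet_subset_of_dvd

theorem exists_irreducible_of_subset_zeroSet {T : Set V} (hT : @IsIrreducible _ (zariskiV b) T)
    {q : MvPolynomial (Fin n) ℂ} (hq : q ≠ 0) (hTq : T ⊆ zeroSet b q) :
    ∃ p, Irreducible p ∧ T ⊆ zeroSet b p := by
  obtain ⟨⟨v, hv⟩, hT⟩ := isIrreducible_zariskiV_iff.1 hT
  induction q using WfDvdMonoid.induction_on_irreducible with
  | zero => exact absurd rfl hq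
  | unit u hu => exact absurd (hTq hv) (hu.map (MvPolynomial.eval (b.equivFun v))).ne_zero
  | mul q p hq' hp ih => exact (hT p q hTq).elim (fun h => ⟨p, hp, h⟩) (ih hq')

theorem exists_compl_subset_zeroSet {U : Set V} (hU : @IsOpen _ (zariskiV b) U) {v : V}
    (hv : v ∈ U) : ∃ q, value b q v ≠ 0 ∧ Uᶜ ⊆ zeroSet b q := by
  let _ := zariskiV b
  obtain ⟨P, hP⟩ := isClosed_zariskiV_iff.1 hU.isClosed_compl
  have hvP : v ∉ ⋂ p ∈ P, zeroSet b p := hP ▸ Set.notMem_compl_iff.2 hv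
  rw [Set.mem_iInter₂] at hvP
  push Not at hvP
  obtain ⟨q, hq, hqv⟩ := hvP
  exact ⟨q, hqv, hP ▸ Set.biInter_subset_of_mem hq⟩

theorem eq_of_value_eq_on_isOpen {U : Set V} (hU : @IsOpen _ (zariskiV b) U) (hne : U.Nonempty)
    {p q : MvPolynomial (Fin n) ℂ} (h : ∀ v ∈ U, value b p v = value b q v) : p = q := by
  obtain ⟨v, hv⟩ := hne
  obtain ⟨d, hdv, hd⟩ := exists_compl_subset_zeroSet hU hv
  refine mul_right_cancel₀ (ne_zero_of_value_ne_zero hdv) (eq_of_value_eq (b := b) fun w => ?_)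
  rw [value_mul, value_mul]
  by_cases hw : w ∈ U
  · rw [h w hw]
  · rw [show value b d w = 0 from hd hw, mul_zero, mul_zero]

theorem isIrreducibleComponent_zeroSet {U : Set V} (hU : @IsOpen _ (zariskiV b) U)
    (hne : U.Nonempty) {p : MvPolynomial (Fin n) ℂ} (hp : Irreducible p)
    (hpU : zeroSet b p ⊆ Uᶜ) : IsIrreducibleComponent b Uᶜ (zeroSet b p) := by
  refine ⟨⟨isIrreducible_zeroSet hp, hpU⟩, fun T hT hpT => ?_⟩
  obtain ⟨v, hv⟩ := hne
  obtain ⟨d, hdv, hd⟩ := exists_compl_subset_zeroSet hU hv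
  obtain ⟨q, hq, hTq⟩ := exists_irreducible_of_subset_zeroSet hT.1 (ne_zero_of_value_ne_zero hdv)
    (hT.2.trans hd)
  have hpq : p ∣ q := dvd_of_zeroSet_subset hp (hpT.trans hTq)
  exact hTq.trans (zeroSet_subset_of_dvd (hp.dvd_symm hq hpq))

theorem isHypersurface_zeroSet {p : MvPolynomial (Fin n) ℂ} (hp : Irreducible p) :
    IsHypersurface b (zeroSet b p) := by
  refine ⟨p, Nat.pos_of_ne_zero fun hdeg => ?_, rfl⟩
  rw [MvPolynomial.totalDegree_eq_zero_iff_eq_C] at hdeg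
  have hcoeff : p.coeff 0 ≠ 0 := fun h => hp.ne_zero (by rw [hdeg, h, map_zero])
  exact hp.not_isUnit (hdeg ▸ (IsUnit.mk0 _ hcoeff).map MvPolynomial.C)

theorem exists_eq_C_mul_of_zeroSet_eq {p q : MvPolynomial (Fin n) ℂ} (hp : Irreducible p)
    (hq : Irreducible q) (h : zeroSet b q = zeroSet b p) : ∃ c : ℂ, p = MvPolynomial.C c * q := by
  obtain ⟨u, rfl⟩ := associated_of_dvd_dvd (dvd_of_zeroSet_subset hq h.le)
    (dvd_of_zeroSet_subset hp h.ge)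
  obtain ⟨c, -, hc⟩ := MvPolynomial.isUnit_iff_eq_C_of_isReduced.1 u.isUnit
  exact ⟨c, by rw [hc, mul_comm]⟩

variable (b) in
/-- The polynomial `v ↦ p (L v)`, for a linear endomorphism `L` of `V`: the action on polynomials
under which the basic relative invariants are permuted up to constants. -/
def precomp (L : V →ₗ[ℂ] V) : MvPolynomial (Fin n) ℂ →ₐ[ℂ] MvPolynomial (Fin n) ℂ :=
  MvPolynomial.bind₁ fun i => ∑ j, MvPolynomial.C (b.repr (L (b j)) i) * MvPolynomial.X j

theorem value_precomp (L : V →ₗ[ℂ] V) (p : MvPolynomial (Fin n) ℂ) (v : V) :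
    value b (precomp b L p) v = value b p (L v) := by
  refine (MvPolynomial.eval₂Hom_bind₁ (RingHom.id ℂ) _ _ p).trans ?_
  have hL : L v = ∑ j, b.repr v j • L (b j) := by
    conv_lhs => rw [← b.sum_repr v]
    simp only [map_sum, map_smul]
  refine congrArg (fun x => MvPolynomial.eval x p) (funext fun i => ?_)
  simp [hL, mul_comm]

theorem irreducible_precomp {L : V →ₗ[ℂ] V} (hL : IsUnit L) {p : MvPolynomial (Fin n) ℂ}
    (hp : Irreducible p) : Irreducible (precomp b L p) := by
  obtain ⟨u, rfl⟩ := hL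
  let e : MvPolynomial (Fin n) ℂ ≃ₐ[ℂ] MvPolynomial (Fin n) ℂ :=
    AlgEquiv.ofAlgHom (precomp b u) (precomp b (u⁻¹ : (V →ₗ[ℂ] V)ˣ))
      (AlgHom.ext fun q => eq_of_value_eq (b := b) fun v => by
        simp [value_precomp, ← Module.End.mul_apply])
      (AlgHom.ext fun q => eq_of_value_eq (b := b) fun v => by
        simp [value_precomp, ← Module.End.mul_apply])
  exact (MulEquiv.irreducible_iff e).2 hp

end ZariskiTopology

section Connectedness

theorem apply_eq_of_isClosed_fiber {X κ : Type*} [TopologicalSpace X] [PreconnectedSpace X]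
    [Finite κ] {k : X → κ} (hk : ∀ i, IsClosed (k ⁻¹' {i})) (x y : X) : k x = k y := by
  let _ : TopologicalSpace κ := ⊥
  have : DiscreteTopology κ := ⟨rfl⟩
  refine PreconnectedSpace.constant inferInstance (continuous_iff_isClosed.2 fun s _ => ?_)
  rw [← Set.biUnion_preimage_singleton]
  exact s.toFinite.isClosed_biUnion fun i _ => hk i

variable {m n : ℕ} {V : Type*} [AddCommGroup V] [Module ℂ V] {b : Module.Basis (Fin n) ℂ V}
  {G : Subgroup (GL (Fin m) ℂ)} {ρ : Representation ℂ G V}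

variable (G) in
/-- The Zariski topology on a subgroup of `GL_m(ℂ)`, in which connectedness is applied to subsets
cut out by regular functions. -/
@[reducible] def zariskiSubgroup : TopologicalSpace G :=
  TopologicalSpace.induced Subtype.val (zariskiGL m)

theorem IsRegular.mul_const {F : G → ℂ} (hF : IsRegular G F) (c : ℂ) :
    IsRegular G fun g => F g * c := by
  obtain ⟨p, hp⟩ := hF
  exact ⟨p * MvPolynomial.C c, fun g => by simp only [hp, map_mul, MvPolynomial.eval_C]⟩

theorem IsRegular.sub {F H : G → ℂ} (hF : IsRegular G F) (hH : IsRegular G H) :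
    IsRegular G fun g => F g - H g := by
  obtain ⟨p, hp⟩ := hF
  obtain ⟨q, hq⟩ := hH
  exact ⟨p - q, fun g => by simp only [hp, hq, map_sub]⟩

theorem IsRegular.isClosed_setOf_eq_zero {F : G → ℂ} (hF : IsRegular G F) :
    @IsClosed _ (zariskiSubgroup G) {g | F g = 0} := by
  obtain ⟨p, hp⟩ := hF
  let _ := zariski (Option (Fin m × Fin m))
  let _ := zariskiGL m
  have hclosed : IsClosed {x | MvPolynomial.eval x p = 0} :=
    (isClosed_zariski_iff _).2 ⟨{p}, by simp only [Set.mem_singleton_iff, forall_eq]⟩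
  simp only [hp]
  exact (hclosed.preimage continuous_induced_dom).preimage continuous_induced_dom

theorem IsRational.isRegular_value (hρ : IsRational ρ) (p : MvPolynomial (Fin n) ℂ) (v : V) :
    IsRegular G fun g => value b p (ρ g v) := by
  choose q hq using fun i => hρ v (b.coord i)
  refine ⟨MvPolynomial.bind₁ q p, fun g => ?_⟩
  refine Eq.trans ?_ (MvPolynomial.eval₂Hom_bind₁ (RingHom.id ℂ) _ q p).symm
  exact congrArg (fun x => MvPolynomial.eval x p) (funext fun i => hq i g)

theorem IsRational.isClosed_setOf_proportional (hρ : IsRational ρ) (p q : MvPolynomial (Fin n) ℂ) :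
    @IsClosed _ (zariskiSubgroup G)
      {g | ∀ v w, value b p (ρ g v) * value b q w = value b p (ρ g w) * value b q v} := by
  let _ := zariskiSubgroup G
  simp only [Set.ofPred_forall, ← sub_eq_zero (a := value b p _ * _)]
  exact isClosed_iInter fun v => isClosed_iInter fun w =>
    (((hρ.isRegular_value p v).mul_const _).sub
      ((hρ.isRegular_value p w).mul_const _)).isClosed_setOf_eq_zero

theorem preconnectedSpace_zariskiSubgroup
    (hG : @IsPreconnected _ (zariskiGL m) (G : Set (GL (Fin m) ℂ))) :
    @PreconnectedSpace G (zariskiSubgroup G) :=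
  @Subtype.preconnectedSpace _ (zariskiGL m) _ hG

end Connectedness

section RelativeInvariants

variable {n : ℕ} {V : Type*} [AddCommGroup V] [Module ℂ V] {b : Module.Basis (Fin n) ℂ V}
  {A : Type*} [Group A] {ρ : Representation ℂ A V} {Ω : Set V}
  {p q : MvPolynomial (Fin n) ℂ} {χ : A →* ℂ}

variable (b ρ Ω) in
/-- `Ω` is an orbit of the representation `ρ`, open for the Zariski topology: the part of
`IsPrehomogeneous` that makes sense for a representation of an abstract group. -/
structure IsOpenOrbit : Prop where
  isOrbit : ∃ v : V, Ω = Set.range (fun g : A => ρ g v)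
  isOpen : @IsOpen _ (zariskiV b) Ω

theorem IsOpenOrbit.nonempty (hΩ : IsOpenOrbit b ρ Ω) : Ω.Nonempty := by
  obtain ⟨v, rfl⟩ := hΩ.isOrbit
  exact Set.range_nonempty _

theorem IsOpenOrbit.apply_mem (hΩ : IsOpenOrbit b ρ Ω) {v : V} (hv : v ∈ Ω) (g : A) :
    ρ g v ∈ Ω := by
  obtain ⟨w, rfl⟩ := hΩ.isOrbit
  obtain ⟨a, rfl⟩ := hv
  exact ⟨g * a, by simp only [map_mul, Module.End.mul_apply]⟩

theorem IsOpenOrbit.exists_apply_eq (hΩ : IsOpenOrbit b ρ Ω) {v w : V} (hv : v ∈ Ω)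
    (hw : w ∈ Ω) : ∃ g, ρ g v = w := by
  obtain ⟨u, rfl⟩ := hΩ.isOrbit
  obtain ⟨a, rfl⟩ := hv
  obtain ⟨c, rfl⟩ := hw
  exact ⟨c * a⁻¹, by rw [← Module.End.mul_apply, ← map_mul, inv_mul_cancel_right]⟩

variable (b ρ p χ) in
/-- The polynomial `p` is a relative invariant of the representation `ρ`, with character `χ`. -/
def IsRelativeInvariant : Prop :=
  ∀ g v, value b p (ρ g v) = χ g * value b p v

theorem exists_isRelativeInvariant_of_forall_exists {v : V} (hv : value b p v ≠ 0)
    (h : ∀ g, ∃ c : ℂ, ∀ w, value b p (ρ g w) = c * value b p w) :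
    ∃ χ : A →* ℂ, IsRelativeInvariant b ρ p χ := by
  choose c hc using h
  refine ⟨⟨⟨c, ?_⟩, fun g g' => ?_⟩, hc⟩
  · refine mul_right_cancel₀ hv ?_
    rw [← hc, map_one, Module.End.one_apply, one_mul]
  · refine mul_right_cancel₀ hv ?_
    rw [← hc, map_mul, Module.End.mul_apply, hc, hc, mul_assoc]

theorem IsRelativeInvariant.C_mul (hp : IsRelativeInvariant b ρ p χ) (c : ℂ) :
    IsRelativeInvariant b ρ (MvPolynomial.C c * p) χ := fun g v => by
  rw [value_mul, value_mul, value_C, value_C, hp, mul_left_comm]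

theorem IsRelativeInvariant.finsuppProd {σ : Type*} {f : σ → MvPolynomial (Fin n) ℂ}
    {χ : σ → A →* ℂ} (hf : ∀ i, IsRelativeInvariant b ρ (f i) (χ i)) (γ : σ →₀ ℕ) :
    IsRelativeInvariant b ρ (γ.prod fun i k => f i ^ k) (γ.prod fun i k => χ i ^ k) := by
  have hvalue (v : V) : value b (γ.prod fun i k => f i ^ k) v =
      γ.prod fun i k => value b (f i) v ^ k := by
    simp only [value, map_finsuppProd, map_pow]
  intro g v
  rw [hvalue, hvalue]
  simp only [Finsupp.prod, MonoidHom.finsetProd_apply, MonoidHom.pow_apply,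
    ← Finset.prod_mul_distrib, ← mul_pow, hf _ g v]

theorem IsRelativeInvariant.associated (hΩ : IsOpenOrbit b ρ Ω)
    (hp : IsRelativeInvariant b ρ p χ) (hq : IsRelativeInvariant b ρ q χ) {v : V} (hv : v ∈ Ω)
    (hpv : value b p v ≠ 0) (hqv : value b q v ≠ 0) : Associated p q := by
  have hunit {c : ℂ} (hc : c ≠ 0) : IsUnit (MvPolynomial.C (σ := Fin n) c) :=
    (IsUnit.mk0 c hc).map MvPolynomial.C
  have heq : MvPolynomial.C (value b q v) * p = MvPolynomial.C (value b p v) * q := by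
    refine eq_of_value_eq_on_isOpen hΩ.isOpen hΩ.nonempty fun w hw => ?_
    obtain ⟨g, rfl⟩ := hΩ.exists_apply_eq hv hw
    rw [value_mul, value_mul, value_C, value_C, hp, hq]
    ring
  refine (associated_isUnit_mul_left_iff (hunit hqv)).1 ?_
  exact heq ▸ (associated_isUnit_mul_left_iff (hunit hpv)).2 (Associated.refl q)

theorem commutator_le_ker {M : Type*} [CommMonoid M] (χ : A →* M) : commutator A ≤ χ.ker := by
  rw [← MonoidHom.ker_toHomUnits]
  exact Abelianization.commutator_subset_ker _

end RelativeInvariants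

theorem emultiplicity_finsuppProd {R ι : Type*} [CommMonoidWithZero R] [IsCancelMulZero R]
    {f : ι → R} (hf : ∀ i, Prime (f i)) (hinj : ∀ i j, f i ∣ f j → i = j) (γ : ι →₀ ℕ) (i : ι) :
    emultiplicity (f i) (γ.prod fun j k => f j ^ k) = γ i := by
  classical
  rw [Finsupp.prod, Finset.emultiplicity_prod (hf i), Finset.sum_eq_single i]
  · exact emultiplicity_pow_self_of_prime (hf i) _
  · intro j _ hji
    rw [emultiplicity_eq_zero]
    exact fun hdvd => hji (hinj i j ((hf i).dvd_of_dvd_pow hdvd)).symm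
  · intro hi
    rw [Finsupp.notMem_support_iff.1 hi, pow_zero, emultiplicity_of_one_right (hf i).not_isUnit]

theorem eq_zero_iff_of_proportional {X K : Type*} [MulZeroClass K] [NoZeroDivisors K]
    {P Q : X → K} (h : ∀ x y, P x * Q y = P y * Q x) {x₀ : X} (hP : P x₀ ≠ 0) (hQ : Q x₀ ≠ 0)
    (x : X) : P x = 0 ↔ Q x = 0 := by
  rw [← mul_eq_zero_iff_right hQ, h, mul_eq_zero_iff_left hP]

namespace IsBasicRelativeInvariants

variable {m n r : ℕ} {V : Type*} [AddCommGroup V] [Module ℂ V] {b : Module.Basis (Fin n) ℂ V}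
  {Ω : Set V} {f : Fin r → MvPolynomial (Fin n) ℂ}

theorem value_ne_zero (hf : IsBasicRelativeInvariants b Ω f) (i : Fin r) {v : V} (hv : v ∈ Ω) :
    value b (f i) v ≠ 0 := fun h =>
  ((hf.components _).2 ⟨i, rfl⟩).1.1.2 h hv

theorem eq_of_dvd (hf : IsBasicRelativeInvariants b Ω f) (i j : Fin r) (h : f i ∣ f j) : i = j :=
  hf.distinct <| (zeroSet_subset_of_dvd h).antisymm <|
    zeroSet_subset_of_dvd ((hf.irreducible i).dvd_symm (hf.irreducible j) h)

theorem exists_eq_C_mul_of_irreducible (hf : IsBasicRelativeInvariants b Ω f)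
    (hΩ : @IsOpen _ (zariskiV b) Ω) (hne : Ω.Nonempty) {p : MvPolynomial (Fin n) ℂ}
    (hp : Irreducible p) (hpΩ : ∀ v ∈ Ω, value b p v ≠ 0) :
    ∃ (i : Fin r) (c : ℂ), p = MvPolynomial.C c * f i := by
  obtain ⟨i, hi⟩ := (hf.components _).1 ⟨isIrreducibleComponent_zeroSet hΩ hne hp
    fun v hv hvΩ => hpΩ v hvΩ hv, isHypersurface_zeroSet hp⟩
  exact ⟨i, exists_eq_C_mul_of_zeroSet_eq hp (hf.irreducible i) hi⟩

theorem exists_eq_C_mul_prod (hf : IsBasicRelativeInvariants b Ω f)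
    (hΩ : @IsOpen _ (zariskiV b) Ω) (hne : Ω.Nonempty) {q : MvPolynomial (Fin n) ℂ}
    (hq : ∀ v ∈ Ω, value b q v ≠ 0) :
    ∃ (c : ℂ) (γ : Fin r →₀ ℕ), q = MvPolynomial.C c * γ.prod fun i k => f i ^ k := by
  induction q using WfDvdMonoid.induction_on_irreducible with
  | zero =>
    obtain ⟨v, hv⟩ := hne
    exact absurd rfl (ne_zero_of_value_ne_zero (hq v hv))
  | unit u hu =>
    obtain ⟨c, -, rfl⟩ := MvPolynomial.isUnit_iff_eq_C_of_isReduced.1 hu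
    exact ⟨c, 0, by rw [Finsupp.prod_zero_index, mul_one]⟩
  | mul q p _ hp ih =>
    simp only [value_mul, mul_ne_zero_iff] at hq
    obtain ⟨c, γ, rfl⟩ := ih fun v hv => (hq v hv).2
    obtain ⟨i, d, rfl⟩ := hf.exists_eq_C_mul_of_irreducible hΩ hne hp fun v hv => (hq v hv).1
    refine ⟨d * c, Finsupp.single i 1 + γ, ?_⟩
    rw [Finsupp.prod_add_index' (fun _ => pow_zero _) (fun _ => pow_add _),
      Finsupp.prod_single_index (h := fun i k => f i ^ k) (pow_zero _), pow_one, map_mul,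
      mul_mul_mul_comm]

theorem exists_precomp_eq_C_mul (hf : IsBasicRelativeInvariants b Ω f) {A : Type*} [Group A]
    {ρ : Representation ℂ A V} (hΩ : IsOpenOrbit b ρ Ω) (i : Fin r) (g : A) :
    ∃ (k : Fin r) (c : ℂ), precomp b (ρ g) (f i) = MvPolynomial.C c * f k := by
  refine hf.exists_eq_C_mul_of_irreducible hΩ.isOpen hΩ.nonempty
    (irreducible_precomp ((Group.isUnit g).map ρ) (hf.irreducible i)) fun v hv => ?_
  rw [value_precomp]
  exact hf.value_ne_zero i (hΩ.apply_mem hv g)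

theorem eq_of_proportional (hf : IsBasicRelativeInvariants b Ω f) (hne : Ω.Nonempty) {i j : Fin r}
    (h : ∀ v w, value b (f i) v * value b (f j) w = value b (f i) w * value b (f j) v) :
    i = j :=
  have ⟨_, hv⟩ := hne
  hf.distinct <| Set.ext <|
    eq_zero_iff_of_proportional h (hf.value_ne_zero i hv) (hf.value_ne_zero j hv)

theorem exists_isRelativeInvariant (hf : IsBasicRelativeInvariants b Ω f)
    {G : Subgroup (GL (Fin m) ℂ)} {ρ : Representation ℂ G V}
    (hG : @IsPreconnected _ (zariskiGL m) (G : Set (GL (Fin m) ℂ))) (hρ : IsRational ρ)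
    (hΩ : IsOpenOrbit b ρ Ω) (i : Fin r) :
    ∃ χ : G →* ℂ, IsRelativeInvariant b ρ (f i) χ := by
  obtain ⟨v₀, hv₀⟩ := hΩ.nonempty
  choose k c hk using hf.exists_precomp_eq_C_mul hΩ i
  have hvalue (g : G) (v : V) : value b (f i) (ρ g v) = c g * value b (f (k g)) v := by
    rw [← value_precomp, hk, value_mul, value_C]
  have hc (g : G) : c g ≠ 0 :=
    left_ne_zero_of_mul (hvalue g v₀ ▸ hf.value_ne_zero i (hΩ.apply_mem hv₀ g))
  have hfiber (j : Fin r) : k ⁻¹' {j} = {g | ∀ v w, value b (f i) (ρ g v) * value b (f j) w =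
      value b (f i) (ρ g w) * value b (f j) v} := by
    refine Set.ext fun g => ⟨?_, fun h => hf.eq_of_proportional hΩ.nonempty fun v w => ?_⟩
    · rintro rfl v w
      rw [hvalue, hvalue, mul_right_comm]
    · refine mul_left_cancel₀ (hc g) ?_
      rw [← mul_assoc, ← mul_assoc, ← hvalue, ← hvalue, h v w]
  let _ := zariskiSubgroup G
  have := preconnectedSpace_zariskiSubgroup hG
  have hk_const (g : G) : k g = k 1 := apply_eq_of_isClosed_fiber
    (fun j => hfiber j ▸ hρ.isClosed_setOf_proportional (f i) (f j)) g 1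
  have hk_one : (1 : G) ∈ k ⁻¹' {i} := by
    rw [hfiber]
    exact fun v w => by rw [map_one, Module.End.one_apply, Module.End.one_apply, mul_comm]
  exact exists_isRelativeInvariant_of_forall_exists (hf.value_ne_zero i hv₀) fun g =>
    ⟨c g, fun w => by rw [hvalue, hk_const, hk_one]⟩

theorem injective_finsuppProd_character (hf : IsBasicRelativeInvariants b Ω f) {A : Type*}
    [Group A] {ρ : Representation ℂ A V} (hΩ : IsOpenOrbit b ρ Ω) {χ : Fin r → A →* ℂ}
    (hχ : ∀ i, IsRelativeInvariant b ρ (f i) (χ i)) :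
    Function.Injective fun γ : Fin r →₀ ℕ => γ.prod fun i k => χ i ^ k := by
  intro γ δ (hγδ : γ.prod _ = δ.prod _)
  obtain ⟨v, hv⟩ := hΩ.nonempty
  have hvalue (γ : Fin r →₀ ℕ) : value b (γ.prod fun i k => f i ^ k) v ≠ 0 := by
    simp only [value, map_finsuppProd, map_pow]
    exact Finset.prod_ne_zero_iff.2 fun i _ => pow_ne_zero _ (hf.value_ne_zero i hv)
  have hassociated : Associated (γ.prod fun i k => f i ^ k) (δ.prod fun i k => f i ^ k) :=
    IsRelativeInvariant.associated hΩ (.finsuppProd hχ γ) (hγδ ▸ .finsuppProd hχ δ)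
      hv (hvalue γ) (hvalue δ)
  have hprime (i : Fin r) : Prime (f i) := (hf.irreducible i).prime
  ext i
  rw [← ENat.natCast_inj, ← emultiplicity_finsuppProd hprime hf.eq_of_dvd,
    ← emultiplicity_finsuppProd hprime hf.eq_of_dvd,
    emultiplicity_eq_of_associated_right hassociated]

end IsBasicRelativeInvariants

section AdditiveInvariants

theorem value_ne_zero_and_eq_of_hasValue {n : ℕ} {V : Type*} [AddCommGroup V] [Module ℂ V]
    {b : Module.Basis (Fin n) ℂ V} {p q : MvPolynomial (Fin n) ℂ} (hq : q ≠ 0)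
    (hpq : IsRelPrime p q) {v : V} {c : ℂ} (h : HasValue b (frac p q) v c) :
    value b q v ≠ 0 ∧ c = value b p v / value b q v := by
  obtain ⟨p', q', hq', hfrac, rfl⟩ := h
  have hcross : p * q' = p' * q := by
    rw [frac, frac, div_eq_div_iff (by simpa using hq)
      (by simpa using ne_zero_of_value_ne_zero hq'), ← map_mul, ← map_mul] at hfrac
    exact IsFractionRing.injective _ _ hfrac
  obtain ⟨e, rfl⟩ : q ∣ q' := hpq.symm.dvd_of_dvd_mul_left (hcross ▸ dvd_mul_left q p')
  have hqv : value b q v ≠ 0 := left_ne_zero_of_mul (value_mul q e v ▸ hq')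
  refine ⟨hqv, (div_eq_div_iff hq' hqv).2 ?_⟩
  rw [← value_mul, ← value_mul, hcross]

variable {m n : ℕ} {V : Type*} [AddCommGroup V] [Module ℂ V] {b : Module.Basis (Fin n) ℂ V}
  {G : Subgroup (GL (Fin m) ℂ)} {ρ : Representation ℂ G V} {Ω : Set V}
  {p q : MvPolynomial (Fin n) ℂ} {χ : G →* ℂ}

theorem IsRelativeInvariant.commutator_sup_isotropy_le_ker (hp : IsRelativeInvariant b ρ p χ)
    {v : V} (hv : value b p v ≠ 0) : commutator G ⊔ isotropy ρ v ≤ χ.ker := by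
  refine sup_le (commutator_le_ker χ) fun g (hg : ρ g v = v) => MonoidHom.mem_ker.2 ?_
  exact (mul_eq_right₀ hv).1 (by rw [← hp, hg])

theorem IsRelativeInvariant.isInvariantUnder (hp : IsRelativeInvariant b ρ p χ)
    {v : V} (hv : value b p v ≠ 0) :
    IsInvariantUnder b ρ (commutator G ⊔ isotropy ρ v) p := fun g hg w => by
  rw [hp, MonoidHom.mem_ker.1 (hp.commutator_sup_isotropy_le_ker hv hg), one_mul]

namespace IsAdditiveRelativeInvariant

variable {Φ : G → ℂ}

theorem value_ne_zero (h : IsAdditiveRelativeInvariant b ρ Ω (frac p q) Φ) (hq : q ≠ 0)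
    (hpq : IsRelPrime p q) {v : V} (hv : v ∈ Ω) : value b q v ≠ 0 := by
  obtain ⟨-, d, -, hd, -⟩ := h.2 v hv 1
  exact (value_ne_zero_and_eq_of_hasValue hq hpq hd).1

theorem value_div_value_sub (h : IsAdditiveRelativeInvariant b ρ Ω (frac p q) Φ) (hq : q ≠ 0)
    (hpq : IsRelPrime p q) {v : V} (hv : v ∈ Ω) (g : G) :
    value b p (ρ g v) / value b q (ρ g v) - value b p v / value b q v = Φ g := by
  obtain ⟨c, d, hc, hd, hcd⟩ := h.2 v hv g
  rw [← hcd, (value_ne_zero_and_eq_of_hasValue hq hpq hc).2,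
    (value_ne_zero_and_eq_of_hasValue hq hpq hd).2]

theorem value_numerator_apply (h : IsAdditiveRelativeInvariant b ρ Ω (frac p q) Φ) (hq : q ≠ 0)
    (hpq : IsRelPrime p q) (hΩ : IsOpenOrbit b ρ Ω) (hqχ : IsRelativeInvariant b ρ q χ) (g : G)
    (v : V) : value b p (ρ g v) = χ g * (value b p v + Φ g * value b q v) := by
  have heq : precomp b (ρ g) p =
      MvPolynomial.C (χ g) * (p + MvPolynomial.C (Φ g) * q) := by
    refine eq_of_value_eq_on_isOpen hΩ.isOpen hΩ.nonempty fun v hv => ?_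
    have hqv : value b q v ≠ 0 := h.value_ne_zero hq hpq hv
    have hqgv : value b q (ρ g v) ≠ 0 := h.value_ne_zero hq hpq (hΩ.apply_mem hv g)
    rw [value_precomp, value_mul, value_add, value_mul, value_C, value_C,
      ← h.value_div_value_sub hq hpq hv g, sub_mul, div_mul_cancel₀ _ hqv, add_sub_cancel,
      mul_left_comm, ← hqχ, div_mul_cancel₀ _ hqgv]
  rw [← value_precomp, heq, value_mul, value_add, value_mul, value_C, value_C]

theorem isInvariantUnder (h : IsAdditiveRelativeInvariant b ρ Ω (frac p q) Φ) (hq : q ≠ 0)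
    (hpq : IsRelPrime p q) (hΩ : IsOpenOrbit b ρ Ω) (hqχ : IsRelativeInvariant b ρ q χ) {v : V}
    (hv : value b q v ≠ 0) : IsInvariantUnder b ρ (commutator G ⊔ isotropy ρ v) p := by
  have hlaw := h.value_numerator_apply hq hpq hΩ hqχ
  have hχ : commutator G ⊔ isotropy ρ v ≤ χ.ker := hqχ.commutator_sup_isotropy_le_ker hv
  let Φhom : G →* Multiplicative ℂ :=
    MonoidHom.mk' (fun g => Multiplicative.ofAdd (Φ g)) fun a c => congrArg _ (h.1.2 a c)
  have hΦ : commutator G ⊔ isotropy ρ v ≤ Φhom.ker := by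
    refine sup_le (commutator_le_ker Φhom) fun g (hg : ρ g v = v) => MonoidHom.mem_ker.2 ?_
    have hgv := hlaw g v
    rw [hg, MonoidHom.mem_ker.1 (hχ (Subgroup.mem_sup_right hg)), one_mul, left_eq_add,
      mul_eq_zero_iff_right hv] at hgv
    exact congrArg Multiplicative.ofAdd hgv
  intro g hg w
  have hΦg : Φ g = 0 := congrArg Multiplicative.toAdd (MonoidHom.mem_ker.1 (hΦ hg))
  rw [hlaw, MonoidHom.mem_ker.1 (hχ hg), hΦg, zero_mul, add_zero, one_mul]

end IsAdditiveRelativeInvariant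

end AdditiveInvariants

section OrbitMap

variable {n : ℕ} {V : Type*} [AddCommGroup V] [Module ℂ V] {b : Module.Basis (Fin n) ℂ V}
  {A : Type*} [Group A] {ρ : Representation ℂ A V} {v : V}

variable (b ρ v) in
/-- Pullback of polynomials along the orbit map `a ↦ ρ a v`, which turns relative invariants into
multiples of their characters. -/
def orbitPullback : MvPolynomial (Fin n) ℂ →ₐ[ℂ] A → ℂ :=
  MvPolynomial.aeval fun i a => b.equivFun (ρ a v) i

theorem orbitPullback_apply (p : MvPolynomial (Fin n) ℂ) (a : A) :
    orbitPullback b ρ v p a = value b p (ρ a v) := by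
  refine (MvPolynomial.comp_aeval_apply _ (Pi.evalAlgHom ℂ (fun _ : A => ℂ) a) p).trans ?_
  rw [MvPolynomial.aeval_eq_eval]
  rfl

theorem algebraicIndependent_of_orbit {σ ι : Type*} {f : σ → MvPolynomial (Fin n) ℂ}
    {χ : σ → A →* ℂ} (hf : ∀ i, IsRelativeInvariant b ρ (f i) (χ i))
    (hfv : ∀ i, value b (f i) v ≠ 0)
    (hχ : Function.Injective fun γ : σ →₀ ℕ => γ.prod fun i k => χ i ^ k) {Φ : ι → A → ℂ}
    (hadd : ∀ i a c, Φ i (a * c) = Φ i a + Φ i c) (hΦ : LinearIndependent ℂ Φ)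
    {g h : ι → MvPolynomial (Fin n) ℂ} (hg : ∀ i, g i ∈ Algebra.adjoin ℂ (Set.range f))
    (hgv : ∀ i a, value b (g i) (ρ a v) ≠ 0)
    (hh : ∀ i a, value b (h i) (ρ a v) / value b (g i) (ρ a v) -
      value b (h i) v / value b (g i) v = Φ i a) :
    AlgebraicIndependent ℂ (Sum.elim f h) := by
  let pullback := orbitPullback b ρ v
  have hquotient : AlgebraicIndependent ℂ
      (Sum.elim (pullback ∘ f) fun i a => value b (h i) (ρ a v) / value b (g i) (ρ a v)) := by
    have hpullback_f : pullback ∘ f = fun i a => value b (f i) v * χ i a := by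
      ext i a
      exact (orbitPullback_apply (f i) a).trans ((hf i a v).trans (mul_comm _ _))
    have hquotient_eq : (fun i a => value b (h i) (ρ a v) / value b (g i) (ρ a v)) =
        fun i a => Φ i a + value b (h i) v / value b (g i) v := by
      ext i a
      rw [← hh, sub_add_cancel]
    rw [hpullback_f, hquotient_eq]
    exact algebraicIndependent_sumElim_mul_character_add hχ hadd hΦ hfv _
  have hadjoin (i : ι) : pullback (g i) ∈ Algebra.adjoin ℂ (Set.range (pullback ∘ f)) := by
    rw [Set.range_comp, ← AlgHom.map_adjoin]
    exact Subalgebra.mem_map.2 ⟨_, hg i, rfl⟩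
  have hregular (i : ι) : pullback (g i) ∈ nonZeroDivisors (A → ℂ) :=
    (Pi.isUnit_iff.2 fun a =>
      ((orbitPullback_apply (g i) a).trans_ne (hgv i a)).isUnit).mem_nonZeroDivisors
  have hpullback_h : pullback ∘ h =
      (pullback ∘ g) * fun i a => value b (h i) (ρ a v) / value b (g i) (ρ a v) := by
    ext i a
    exact (orbitPullback_apply (h i) a).trans <| by
      rw [Pi.mul_apply, Pi.mul_apply, Function.comp_apply, orbitPullback_apply,
        mul_div_cancel₀ _ (hgv i a)]
  refine AlgebraicIndependent.of_comp pullback ?_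
  rw [Sum.comp_elim, hpullback_h]
  exact algebraicIndependent_sumElim_mul_right hquotient hadjoin hregular

end OrbitMap

theorem IsPrehomogeneous.isOpenOrbit {m n : ℕ} {V : Type*} [AddCommGroup V] [Module ℂ V]
    {b : Module.Basis (Fin n) ℂ V} {G : Subgroup (GL (Fin m) ℂ)} {ρ : Representation ℂ G V}
    {Ω : Set V} (h : IsPrehomogeneous b G ρ Ω) : IsOpenOrbit b ρ Ω :=
  ⟨h.isOrbit, h.isOpen⟩

end Prehomogeneous

open Prehomogeneous in
theorem mainTheorem8_general {m n r : ℕ} {V : Type*} [AddCommGroup V] [Module ℂ V]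
    {b : Module.Basis (Fin n) ℂ V} {G : Subgroup (GL (Fin m) ℂ)} {ρ : Representation ℂ G V}
    {Ω : Set V} (hG : @IsPreconnected _ (zariskiGL m) (G : Set (GL (Fin m) ℂ)))
    (hρ : IsRational ρ) (hΩ : IsOpenOrbit b ρ Ω) {f : Fin r → MvPolynomial (Fin n) ℂ}
    (hf : IsBasicRelativeInvariants b Ω f) {ι : Type*} {Φ : ι → G → ℂ}
    (hindep : LinearIndependent ℂ Φ) {h g : ι → MvPolynomial (Fin n) ℂ} (hg : ∀ i, g i ≠ 0)
    (hlowest : ∀ i, IsRelPrime (h i) (g i))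
    (hΦ : ∀ i, IsAdditiveRelativeInvariant b ρ Ω (frac (h i) (g i)) (Φ i)) :
    (∀ i v, value b (f i) v ≠ 0 → IsInvariantUnder b ρ (commutator G ⊔ isotropy ρ v) (f i)) ∧
    (∀ i v, value b (g i) v ≠ 0 → IsInvariantUnder b ρ (commutator G ⊔ isotropy ρ v) (h i)) ∧
    AlgebraicIndependent ℂ (Sum.elim f h) := by
  obtain ⟨v₀, hv₀⟩ := hΩ.nonempty
  have hgΩ (i : ι) {v : V} (hv : v ∈ Ω) : value b (g i) v ≠ 0 :=
    (hΦ i).value_ne_zero (hg i) (hlowest i) hv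
  choose χ hχ using hf.exists_isRelativeInvariant hG hρ hΩ
  choose c γ hcγ using fun i => hf.exists_eq_C_mul_prod hΩ.isOpen hΩ.nonempty fun _ => hgΩ i
  have hgχ (i : ι) : IsRelativeInvariant b ρ (g i) ((γ i).prod fun j k => χ j ^ k) :=
    hcγ i ▸ (IsRelativeInvariant.finsuppProd hχ (γ i)).C_mul (c i)
  have hgf (i : ι) : g i ∈ Algebra.adjoin ℂ (Set.range f) := by
    rw [hcγ i]
    exact mul_mem (Subalgebra.algebraMap_mem _ (c i)) <| prod_mem fun j _ =>
      pow_mem (Algebra.subset_adjoin (Set.mem_range_self j)) _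
  exact ⟨fun i _ => (hχ i).isInvariantUnder,
    fun i _ => (hΦ i).isInvariantUnder (hg i) (hlowest i) hΩ (hgχ i),
    algebraicIndependent_of_orbit hχ (fun i => hf.value_ne_zero i hv₀)
      (hf.injective_finsuppProd_character hΩ hχ) (fun i => (hΦ i).1.2) hindep hgf
      (fun i a => hgΩ i (hΩ.apply_mem hv₀ a))
      fun i => (hΦ i).value_div_value_sub (hg i) (hlowest i) hv₀⟩

end

theorem mainTheorem8 {m n r s : ℕ} {V : Type*} [AddCommGroup V] [Module ℂ V]
    (b : Module.Basis (Fin n) ℂ V) (G : Subgroup (GL (Fin m) ℂ)) (ρ : Representation ℂ G V)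
    (Ω : Set V) (hPV : Prehomogeneous.IsPrehomogeneous b G ρ Ω)
    (f : Fin r → MvPolynomial (Fin n) ℂ)
    (hf : Prehomogeneous.IsBasicRelativeInvariants b Ω f)
    (Φ : Module.Basis (Fin s) ℂ (Prehomogeneous.additiveFunctionsOne b ρ Ω))
    (h g : Fin s → MvPolynomial (Fin n) ℂ)
    (hg : ∀ i, g i ≠ 0) (hlowest : ∀ i, IsRelPrime (h i) (g i))
    (hΦ : ∀ i, Prehomogeneous.IsAdditiveRelativeInvariant b ρ Ω
      (Prehomogeneous.frac (h i) (g i)) (Φ i : G → ℂ)) :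
    (∀ i,
      (∀ v₀ ∈ Ω, Prehomogeneous.IsInvariantUnder b ρ
        (commutator G ⊔ Prehomogeneous.isotropy ρ v₀) (f i)) ∧
      ∀ j, j ≠ i → ∀ v ∈ Prehomogeneous.zeroSet b (f j),
        (∀ k, k ≠ j → v ∉ Prehomogeneous.zeroSet b (f k)) →
          Prehomogeneous.IsInvariantUnder b ρ (Prehomogeneous.isotropy ρ v) (f i)) ∧
    (∀ i,
      (∀ v₀ ∈ Ω, Prehomogeneous.IsInvariantUnder b ρ
        (commutator G ⊔ Prehomogeneous.isotropy ρ v₀) (h i)) ∧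
      ∀ j, ∀ v ∈ Prehomogeneous.zeroSet b (f j),
        (∀ k, k ≠ j → v ∉ Prehomogeneous.zeroSet b (f k)) →
          Prehomogeneous.value b (g i) v ≠ 0 →
            Prehomogeneous.IsInvariantUnder b ρ (Prehomogeneous.isotropy ρ v) (h i)) ∧
    AlgebraicIndependent ℂ (Sum.elim f h) := by
  obtain ⟨hf_invariant, hh_invariant, hindep⟩ := mainTheorem8_general
    hPV.group.isConnected.2 hPV.rational hPV.isOpenOrbit hf
    (Φ.linearIndependent.map' (Submodule.subtype _) (Submodule.ker_subtype _)) hg hlowest hΦ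
  exact ⟨fun i => ⟨fun v hv => hf_invariant i v (hf.value_ne_zero i hv),
      fun j hj v _ hv a ha => hf_invariant i v (hv i hj.symm) a (Subgroup.mem_sup_right ha)⟩,
    fun i => ⟨fun v hv => hh_invariant i v ((hΦ i).value_ne_zero (hg i) (hlowest i) hv),
      fun _ v _ _ hv a ha => hh_invariant i v hv a (Subgroup.mem_sup_right ha)⟩, hindep⟩
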